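/- **Theorem 2.1.** Let $a,b,n$ be positive integers with $1\le a<b$ and let $G$ be a finite simple graph with minimum degree $\delta(G)\ge a+n$ and isolated toughness $$I(G)\ \ge\ a-1+n+\frac{a-1}{b}.$$ Then for every set $V'\subseteq V(G)$ with $|V'|=n$, the graph $G-V'$ has an $[a,b]$-factor, that is, a spanning subgraph $H$ with $a\le d_H(x)\le b$ for every vertex $x$ of $G-V'$. Here $i(G-S)$ denotes the number of isolated vertices of $G-S$, and $$I(G)=\begin{cases}\min\left\{\dfrac{|S|}{i(G-S)} : S\subseteq V(G),\ i(G-S)\ge 2\right\} & \text{if } G \text{ is not complete},\\[2mm] |V(G)|-1 & \text{if } G \text{ is complete}.\end{cases}$$ -/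

import Mathlib

namespace SimpleGraph

/-- The number `i(G - S)` of isolated vertices (vertices without neighbours) of the graph obtained
from `G` by deleting the vertices in `S`. -/
noncomputable def isolatedCount {V : Type*} (G : SimpleGraph V) (S : Finset V) : ℕ :=
  {v : ((S : Set V)ᶜ : Set V) | (G.induce (S : Set V)ᶜ).IsIsolated v}.ncard

open Classical in
/-- The isolated toughness `I(G)` of a finite graph: the minimum of `|S| / i(G - S)` over the vertex
sets `S` with `i(G - S) ≥ 2` if `G` is not complete, and `|V(G)| - 1` if `G` is complete.
The infimum is a minimum by `isLeast_isolatedToughness` below. -/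
noncomputable def isolatedToughness {V : Type*} [Fintype V] (G : SimpleGraph V) : ℝ :=
  if G = ⊤ then (Fintype.card V : ℝ) - 1
  else sInf {r : ℝ | ∃ S : Finset V, 2 ≤ G.isolatedCount S ∧
    r = (S.card : ℝ) / (G.isolatedCount S : ℝ)}

/-- `G` has an `[a, b]`-factor: a spanning subgraph `H` with `a ≤ d_H(v) ≤ b` for every vertex. -/
def HasFactor {V : Type*} [Finite V] (G : SimpleGraph V) (a b : ℕ) : Prop :=
  ∃ H : SimpleGraph V, H ≤ G ∧ ∀ v : V, a ≤ (H.neighborSet v).ncard ∧ (H.neighborSet v).ncard ≤ b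

theorem isLeast_isolatedToughness {V : Type*} [Fintype V] (G : SimpleGraph V) (hG : G ≠ ⊤) :
    IsLeast {r : ℝ | ∃ S : Finset V, 2 ≤ G.isolatedCount S ∧
      r = (S.card : ℝ) / (G.isolatedCount S : ℝ)} G.isolatedToughness := by
  classical
  have hfin : {r : ℝ | ∃ S : Finset V, 2 ≤ G.isolatedCount S ∧
      r = (S.card : ℝ) / (G.isolatedCount S : ℝ)}.Finite := by
    refine (Set.finite_range
      (fun S : Finset V => (S.card : ℝ) / (G.isolatedCount S : ℝ))).subset ?_
    rintro r ⟨S, -, rfl⟩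
    exact ⟨S, rfl⟩
  have hne : {r : ℝ | ∃ S : Finset V, 2 ≤ G.isolatedCount S ∧
      r = (S.card : ℝ) / (G.isolatedCount S : ℝ)}.Nonempty := by
    obtain ⟨u, v, huv, hadj⟩ : ∃ u v, u ≠ v ∧ ¬ G.Adj u v := by
      by_contra! h
      exact hG (by ext u v; exact ⟨fun h' => h'.ne, fun h' => h u v h'⟩)
    refine ⟨_, Finset.univ \ {u, v}, ?_, rfl⟩
    have hu : u ∈ (((Finset.univ \ {u, v} : Finset V) : Set V)ᶜ : Set V) := by simp
    have hv : v ∈ (((Finset.univ \ {u, v} : Finset V) : Set V)ᶜ : Set V) := by simp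
    have key : ({⟨u, hu⟩, ⟨v, hv⟩} :
        Set (((Finset.univ \ {u, v} : Finset V) : Set V)ᶜ : Set V)).ncard = 2 :=
      Set.ncard_pair (fun h => huv (congrArg Subtype.val h))
    rw [isolatedCount, ← key]
    refine Set.ncard_le_ncard ?_ (Set.toFinite _)
    have hadj' : ¬ G.Adj v u := fun h => hadj h.symm
    rintro x hx ⟨w, hw⟩ hxw
    have hw' : w = u ∨ w = v := by
      by_contra h
      exact hw (by simpa using h)
    rcases hx with rfl | rfl <;> rcases hw' with rfl | rfl <;> simp_all
  rw [isolatedToughness, if_neg hG]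
  exact ⟨hne.csInf_mem hfin, fun r hr => csInf_le hfin.bddBelow hr⟩

end SimpleGraph

/-! Write `H` for `G - V'` and `d` for degrees in `H - S`. As `a < b`,
`exists_factor_of_forall_disjoint` reduces the claim to `∑_T (a - d) ≤ b|S|` for disjoint `S`, `T`.
`exists_isIndepSet_sum_le` replaces the left side by `∑_I (d + 1)(a - d)` with `I ⊆ T` independent.
Deleting `V'`, `S` and the remaining neighbours of `I` isolates `I`, so for `|I| ≥ 2` toughness
gives `I(G)|I| ≤ n + |S| + ∑_I d`, and arithmetic finishes. If `|I| = 1`, the minimum degree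
suffices. The criterion itself comes from alternating walks in a subgraph of least deficiency
(`IsMinDeficient.not_violation`). -/

namespace SimpleGraph

/-! ### Alternating walks and the factor criterion -/

section Factor

variable {V : Type*}

lemma ncard_neighborSet_sup_edge_left [Finite V] {F : SimpleGraph V} {s t : V} (hne : s ≠ t)
    (h : ¬F.Adj s t) :
    ((F ⊔ edge s t).neighborSet s).ncard = (F.neighborSet s).ncard + 1 := by
  rw [← Set.ncard_insert_of_notMem (a := t) (s := F.neighborSet s) h (Set.toFinite _)]
  congr 1
  ext y
  simp only [mem_neighborSet, sup_adj, edge_adj, Set.mem_insert_iff]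
  grind

lemma ncard_neighborSet_sup_edge_right [Finite V] {F : SimpleGraph V} {s t : V} (hne : s ≠ t)
    (h : ¬F.Adj s t) :
    ((F ⊔ edge s t).neighborSet t).ncard = (F.neighborSet t).ncard + 1 := by
  rw [edge_comm]
  exact ncard_neighborSet_sup_edge_left hne.symm fun h' => h h'.symm

lemma ncard_neighborSet_sup_edge_of_ne {F : SimpleGraph V} {s t x : V} (hs : x ≠ s)
    (ht : x ≠ t) : ((F ⊔ edge s t).neighborSet x).ncard = (F.neighborSet x).ncard := by
  congr 1
  ext y
  simp only [mem_neighborSet, sup_adj, edge_adj]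
  grind

lemma sdiff_edge_sup_edge {F : SimpleGraph V} {s t : V} (h : F.Adj s t) :
    F \ edge s t ⊔ edge s t = F := by
  rw [sdiff_sup_cancel]
  exact (edge_le_iff F).2 (Or.inr h)

/-- Exchanging the edge `uw` of `F` for the edge `vu` moves one unit of degree from `w` to `v`. -/
lemma ncard_neighborSet_exchange [Finite V] [DecidableEq V] {F : SimpleGraph V} {v u w : V} (hvu : v ≠ u)
    (hvw : v ≠ w) (h : ¬F.Adj v u) (h' : F.Adj u w) (x : V) :
    (((F \ edge u w) ⊔ edge v u).neighborSet x).ncard + (if x = w then 1 else 0) =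
      (F.neighborSet x).ncard + (if x = v then 1 else 0) := by
  have huw : u ≠ w := h'.ne
  have h1 : ¬(F \ edge u w).Adj u w := by simp [edge_adj, huw]
  have h2 : ¬(F \ edge u w).Adj v u := fun hh => h hh.1
  have e := sdiff_edge_sup_edge h'
  by_cases hxv : x = v
  · subst hxv
    have := ncard_neighborSet_sup_edge_left hvu h2
    have h3 := ncard_neighborSet_sup_edge_of_ne (F := F \ edge u w) hvu hvw
    rw [e] at h3
    rw [this, h3, if_neg hvw, if_pos rfl]
  by_cases hxu : x = u
  · subst hxu
    have := ncard_neighborSet_sup_edge_right hvu h2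
    have h3 := ncard_neighborSet_sup_edge_left huw h1
    rw [e] at h3
    rw [this, h3, if_neg huw, if_neg hxv]
  have := ncard_neighborSet_sup_edge_of_ne (F := F \ edge u w) hxv hxu
  rw [this]
  by_cases hxw : x = w
  · subst hxw
    have h3 := ncard_neighborSet_sup_edge_right huw h1
    rw [e] at h3
    rw [h3, if_pos rfl, if_neg hxv]
  · have h3 := ncard_neighborSet_sup_edge_of_ne (F := F \ edge u w) hxu hxw
    rw [e] at h3
    rw [h3, if_neg hxw, if_neg hxv]

/-- The first `k` steps of `p` are edges of `G` lying alternately outside and inside `F`. -/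
def IsAlternatingWalk (G F : SimpleGraph V) (p : ℕ → V) (k : ℕ) : Prop :=
  ∀ i < k, if Even i then G.Adj (p i) (p (i + 1)) ∧ ¬F.Adj (p i) (p (i + 1))
    else F.Adj (p i) (p (i + 1))

lemma IsAlternatingWalk.mono {G F : SimpleGraph V} {p : ℕ → V} {k l : ℕ}
    (h : IsAlternatingWalk G F p k) (hl : l ≤ k) : IsAlternatingWalk G F p l :=
  fun i hi => h i (hi.trans_le hl)

/-- Cutting out a closed stretch of even length preserves the parity of all later steps. -/
lemma IsAlternatingWalk.shortcut {G F : SimpleGraph V} {p : ℕ → V} {k i c : ℕ}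
    (h : IsAlternatingWalk G F p (k + c)) (hc : Even c) (hi : i ≤ k) (hp : p i = p (i + c)) :
    IsAlternatingWalk G F (fun m => if m ≤ i then p m else p (m + c)) k := by
  intro m hm
  rcases lt_trichotomy m i with hmi | rfl | hmi
  · simpa [hmi.le, Nat.succ_le_of_lt hmi] using h m (by omega)
  · have := h (m + c) (by omega)
    rw [← hp] at this
    simpa [Nat.even_add, hc, add_right_comm] using this
  · have := h (m + c) (by omega)
    simpa [Nat.even_add, hc, add_right_comm, hmi.not_ge, (hmi.trans (Nat.lt_succ_self m)).not_ge]
      using this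

lemma IsAlternatingWalk.extend {G F : SimpleGraph V} {p : ℕ → V} {k : ℕ}
    (h : IsAlternatingWalk G F p k) {y : V}
    (hy : if Even k then G.Adj (p k) y ∧ ¬F.Adj (p k) y else F.Adj (p k) y) :
    IsAlternatingWalk G F (fun m => if m ≤ k then p m else y) (k + 1) := by
  intro m hm
  rcases (Nat.lt_succ_iff.1 hm).lt_or_eq with hmk | rfl
  · simpa [hmk.le, Nat.succ_le_of_lt hmk] using h m hmk
  · simpa using hy

/-- The total amount by which the degrees of `F` fall short of `g`. -/
noncomputable def deficiency [Fintype V] (F : SimpleGraph V) (g : V → ℕ) : ℕ :=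
  ∑ v, (g v - (F.neighborSet v).ncard)

/-- `F` is a subgraph of `G` with degrees at most `f`, of the least possible deficiency. -/
structure IsMinDeficient [Fintype V] (G F : SimpleGraph V) (g f : V → ℕ) : Prop where
  le : F ≤ G
  ncard_le : ∀ v, (F.neighborSet v).ncard ≤ f v
  min : ∀ F' ≤ G, (∀ v, (F'.neighborSet v).ncard ≤ f v) → F.deficiency g ≤ F'.deficiency g

lemma exists_isMinDeficient [Fintype V] (G : SimpleGraph V) (g f : V → ℕ) :
    ∃ F, IsMinDeficient G F g f := by
  have hne : {F : SimpleGraph V | F ≤ G ∧ ∀ v, (F.neighborSet v).ncard ≤ f v}.Nonempty :=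
    ⟨⊥, bot_le, fun v => by simp [neighborSet]⟩
  obtain ⟨F, hF, hmin⟩ := Set.exists_min_image _ (fun F => F.deficiency g) (Set.toFinite _) hne
  exact ⟨F, hF.1, hF.2, fun F' h1 h2 => hmin F' ⟨h1, h2⟩⟩

variable [Fintype V] {G : SimpleGraph V} {g f : V → ℕ}

/-- No alternating walk leads from a vertex of degree below `g` to a vertex at which the degree
could be changed. -/
lemma IsMinDeficient.not_violation (hgf : ∀ v, g v < f v) (k : ℕ) :
    ∀ {F : SimpleGraph V}, IsMinDeficient G F g f → ∀ {p : ℕ → V},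
    (F.neighborSet (p 0)).ncard < g (p 0) → IsAlternatingWalk G F p k →
    if Even k then (F.neighborSet (p k)).ncard ≤ g (p k)
      else (F.neighborSet (p k)).ncard = f (p k) := by
  classical
  -- `F` stays general: the inductive step replaces it by another minimizer.
  induction k using Nat.strong_induction_on with
  | _ k ih =>
  intro F hF p h0 hp
  by_contra hviol
  have hearly : ∀ i < k, if Even i then (F.neighborSet (p i)).ncard ≤ g (p i)
      else (F.neighborSet (p i)).ncard = f (p i) :=
    fun i hi => ih i hi hF h0 (hp.mono hi.le)
  -- A repetition at equal parity could be cut out, leaving a shorter violating walk.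
  have hinj : ∀ i j, i < j → j ≤ k → Even (j - i) → p i ≠ p j := by
    intro i j hij hjk he hpe
    obtain ⟨c, rfl⟩ := Nat.exists_eq_add_of_lt hij
    obtain ⟨l, rfl⟩ := Nat.exists_eq_add_of_le hjk
    have he' : Even (c + 1) := by convert he using 1; omega
    have hp' : IsAlternatingWalk G F p (i + l + (c + 1)) := by convert hp using 1; omega
    have hs := hp'.shortcut he' (Nat.le_add_right i l) hpe
    have := ih (i + l) (by omega) hF (by simpa using h0) hs
    apply hviol
    have e1 : Even (i + c + 1 + l) ↔ Even (i + l) := by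
      rw [show i + c + 1 + l = i + l + (c + 1) by omega, Nat.even_add]
      simp [he']
    have e2 : (if i + l ≤ i then p (i + l) else p (i + l + (c + 1))) = p (i + c + 1 + l) := by
      split_ifs with hl
      · obtain rfl : l = 0 := by omega
        simpa using hpe
      · congr 1; omega
    simp only [e2] at this
    simpa only [e1] using this
  match k, ih, hp, hviol, hearly, hinj with
  | 0, _, _, hviol, _, _ => simp at hviol; omega
  | 1, _, hp, hviol, _, _ =>
    obtain ⟨hG, hnF⟩ : G.Adj (p 0) (p 1) ∧ ¬F.Adj (p 0) (p 1) := by simpa using hp 0 one_pos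
    have hlt : (F.neighborSet (p 1)).ncard < f (p 1) :=
      lt_of_le_of_ne (hF.ncard_le _) (by simpa using hviol)
    have hl := ncard_neighborSet_sup_edge_left hG.ne hnF
    have hr := ncard_neighborSet_sup_edge_right hG.ne hnF
    have hge : ∀ x, (F.neighborSet x).ncard ≤ ((F ⊔ edge (p 0) (p 1)).neighborSet x).ncard :=
      fun x => Set.ncard_le_ncard (fun y hy => Or.inl hy) (Set.toFinite _)
    refine absurd (hF.min (F ⊔ edge (p 0) (p 1))
      (sup_le hF.le ((edge_le_iff G).2 (Or.inr hG))) fun x => ?_) (not_le.2 ?_)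
    · have := hF.ncard_le x
      by_cases hx : x = p 0
      · have := hgf x; subst hx; omega
      by_cases hx' : x = p 1
      · subst hx'; omega
      rw [ncard_neighborSet_sup_edge_of_ne hx hx']
      exact this
    · refine Finset.sum_lt_sum (fun x _ => Nat.sub_le_sub_left (hge x) _)
        ⟨p 0, Finset.mem_univ _, by omega⟩
  | k + 2, ih, hp, hviol, hearly, hinj =>
    obtain ⟨hG, hnF⟩ : G.Adj (p 0) (p 1) ∧ ¬F.Adj (p 0) (p 1) := by
      simpa using hp 0 (by omega)
    have hFa : F.Adj (p 1) (p 2) := by simpa using hp 1 (by omega)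
    have h02 : p 0 ≠ p 2 := hinj 0 2 (by omega) (by omega) (by decide)
    have hex := ncard_neighborSet_exchange hG.ne h02 hnF hFa
    have hd1 : (F.neighborSet (p 1)).ncard = f (p 1) := by simpa using hearly 1 (by omega)
    -- The exchange passes one unit of deficiency from `p 0` to `p 2`, so the rest of the walk
    -- starts at a deficient vertex.
    set F' := (F \ edge (p 1) (p 2)) ⊔ edge (p 0) (p 1) with hF'
    have hle' : F' ≤ G := sup_le (sdiff_le.trans hF.le) ((edge_le_iff G).2 (Or.inr hG))
    have hcard' : ∀ v, (F'.neighborSet v).ncard ≤ f v := by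
      intro v
      have h1 := hex v
      have h2 := hF.ncard_le v
      have h3 := hgf v
      by_cases hv : v = p 0
      · subst hv; simp [h02] at h1; omega
      · simp [hv] at h1; omega
    have hw0 := hex (p 2)
    have hv0 := hex (p 0)
    simp only [if_true, if_neg h02, if_neg h02.symm] at hw0 hv0
    have hrest : ∀ x, x ≠ p 0 → x ≠ p 2 →
        (F'.neighborSet x).ncard = (F.neighborSet x).ncard := by
      intro x hx hx'
      simpa [hx, hx'] using hex x
    have hsum : ∀ H : SimpleGraph V, H.deficiency g = (g (p 0) - (H.neighborSet (p 0)).ncard) +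
        ((g (p 2) - (H.neighborSet (p 2)).ncard) +
          ∑ x ∈ (Finset.univ.erase (p 0)).erase (p 2), (g x - (H.neighborSet x).ncard)) := by
      intro H
      rw [Finset.add_sum_erase _ (fun x => g x - (H.neighborSet x).ncard)
        (Finset.mem_erase.2 ⟨h02.symm, Finset.mem_univ _⟩),
        Finset.add_sum_erase _ (fun x => g x - (H.neighborSet x).ncard) (Finset.mem_univ _),
        deficiency]
    have hsumeq : ∑ x ∈ (Finset.univ.erase (p 0)).erase (p 2), (g x - (F'.neighborSet x).ncard) =
        ∑ x ∈ (Finset.univ.erase (p 0)).erase (p 2), (g x - (F.neighborSet x).ncard) := by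
      refine Finset.sum_congr rfl fun x hx => ?_
      simp only [Finset.mem_erase, Finset.mem_univ, and_true] at hx
      rw [hrest x hx.2 hx.1]
    have hmin := hF.min F' hle' hcard'
    rw [hsum F, hsum F', hsumeq] at hmin
    -- Otherwise `p 2` could spare an edge and the exchange would lower the deficiency.
    have hd2 : (F.neighborSet (p 2)).ncard ≤ g (p 2) := by omega
    have hdef : F'.deficiency g = F.deficiency g := by
      rw [hsum F, hsum F', hsumeq]; omega
    have hF'min : IsMinDeficient G F' g f :=
      ⟨hle', hcard', fun H h1 h2 => hdef ▸ hF.min H h1 h2⟩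
    -- No later step uses an exchanged edge: equal-parity coincidences violate `hinj`, and opposite
    -- parities have degrees `≤ g` and `= f > g`.
    have hp' : IsAlternatingWalk G F' (fun m => p (m + 2)) k := by
      intro m hm
      have hm2 := hp (m + 2) (by omega)
      have he := hearly (m + 2) (by omega)
      have heven : Even (m + 2) ↔ Even m := by simp [Nat.even_add]
      by_cases hme : Even m
      · simp only [heven, hme, if_true] at hm2 he ⊢
        refine ⟨hm2.1, ?_⟩
        rintro (hh | hh)
        · exact hm2.2 hh.1
        · rw [edge_adj] at hh
          rcases hh.1 with ⟨h1, -⟩ | ⟨h1, -⟩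
          · exact hinj 0 (m + 2) (by omega) (by omega) (by simpa [heven] using hme) h1.symm
          · have := hgf (p 1)
            rw [h1] at he
            omega
      · simp only [heven, hme, if_false] at hm2 he ⊢
        refine Or.inl ⟨hm2, fun hh => ?_⟩
        rw [edge_adj] at hh
        rcases hh.1 with ⟨h1, -⟩ | ⟨h1, -⟩
        · refine hinj 1 (m + 2) (by omega) (by omega) ?_ h1.symm
          rw [Nat.even_sub (by omega)]
          simp [heven, hme]
        · have := hgf (p 2)
          rw [h1] at he
          omega
    have hfin := ih k (by omega) hF'min (p := fun m => p (m + 2)) (by simp only [zero_add]; omega)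
      hp'
    apply hviol
    have heven : Even (k + 2) ↔ Even k := by simp [Nat.even_add]
    by_cases hke : Even k
    · simp only [heven, hke, if_true] at hfin ⊢
      rcases Nat.eq_zero_or_pos k with rfl | hkpos
      · exact hd2
      rwa [hrest] at hfin
      · exact (hinj 0 (k + 2) (by omega) le_rfl (by simpa [heven] using hke)).symm
      · exact (hinj 2 (k + 2) (by omega) le_rfl (by simpa using hke)).symm
    · simp only [heven, hke, if_false] at hfin ⊢
      have hc := hgf (p (k + 2))
      by_cases hx0 : p (k + 2) = p 0
      · rw [hx0] at hfin hc ⊢; omega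
      by_cases hx2 : p (k + 2) = p 2
      · rw [hx2] at hfin hc ⊢; omega
      rwa [hrest _ hx0 hx2] at hfin

open Classical in
/-- The factor theorem for degree bounds `g < f`: a spanning subgraph with degrees between `g`
and `f` exists if `∑_T g ≤ ∑_S f + ∑_{x ∈ T} d_{G - S}(x)` for all disjoint `S` and `T`. -/
theorem exists_factor_of_forall_disjoint (G : SimpleGraph V) (hgf : ∀ v, g v < f v)
    (h : ∀ S T : Finset V, Disjoint S T →
      ∑ x ∈ T, g x ≤ ∑ x ∈ S, f x + ∑ x ∈ T, {y | G.Adj x y ∧ y ∉ S}.ncard) :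
    ∃ H ≤ G, ∀ v, g v ≤ (H.neighborSet v).ncard ∧ (H.neighborSet v).ncard ≤ f v := by
  obtain ⟨F, hF⟩ := exists_isMinDeficient G g f
  refine ⟨F, hF.le, fun v₀ => ⟨?_, hF.ncard_le v₀⟩⟩
  by_contra! hv₀
  -- `T` and `S` are the ends of even and odd alternating walks from deficient vertices; they
  -- violate the hypothesis.
  let T : Finset V := {x | ∃ p k, (F.neighborSet (p 0)).ncard < g (p 0) ∧
    IsAlternatingWalk G F p k ∧ Even k ∧ p k = x}
  let S : Finset V := {x | ∃ p k, (F.neighborSet (p 0)).ncard < g (p 0) ∧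
    IsAlternatingWalk G F p k ∧ ¬Even k ∧ p k = x}
  have hT : ∀ x ∈ T, (F.neighborSet x).ncard ≤ g x := by
    intro x hx
    obtain ⟨p, k, h0, hp, hk, rfl⟩ := (Finset.mem_filter.1 hx).2
    simpa [hk] using hF.not_violation hgf k h0 hp
  have hS : ∀ x ∈ S, (F.neighborSet x).ncard = f x := by
    intro x hx
    obtain ⟨p, k, h0, hp, hk, rfl⟩ := (Finset.mem_filter.1 hx).2
    simpa only [hk, if_false] using hF.not_violation hgf k h0 hp
  have hv₀T : v₀ ∈ T :=
    Finset.mem_filter.2 ⟨Finset.mem_univ _, fun _ => v₀, 0, hv₀, fun i hi => by omega, by simp⟩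
  have hdisj : Disjoint S T := by
    refine Finset.disjoint_left.2 fun x hxS hxT => ?_
    have := hS x hxS
    have := hT x hxT
    have := hgf x
    omega
  have hTS : ∀ x ∈ T, ∀ y, G.Adj x y → ¬F.Adj x y → y ∈ S := by
    intro x hx y hG hnF
    obtain ⟨p, k, h0, hp, hk, rfl⟩ := (Finset.mem_filter.1 hx).2
    refine Finset.mem_filter.2 ⟨Finset.mem_univ _, _, k + 1, ?_, hp.extend (y := y) ?_, ?_, ?_⟩
    · simpa using h0
    · simp [hk, hG, hnF]
    · simpa [Nat.even_add_one] using hk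
    · simp
  have hST : ∀ x ∈ S, ∀ y, F.Adj x y → y ∈ T := by
    intro x hx y hFa
    obtain ⟨p, k, h0, hp, hk, rfl⟩ := (Finset.mem_filter.1 hx).2
    refine Finset.mem_filter.2 ⟨Finset.mem_univ _, _, k + 1, ?_, hp.extend (y := y) ?_, ?_, ?_⟩
    · simpa using h0
    · simp only [hk, if_false, hFa]
    · simpa [Nat.even_add_one] using hk
    · simp
  -- All `F`-edges at `S` go to `T`, and all `G`-edges from `T` to outside `S` lie in `F`.
  have hcount : ∑ x ∈ T, (F.neighborSet x).ncard =
      ∑ x ∈ S, f x + ∑ x ∈ T, {y | G.Adj x y ∧ y ∉ S}.ncard := by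
    have h1 : ∀ x ∈ T, (F.neighborSet x).ncard =
        (S.bipartiteAbove F.Adj x).card + {y | G.Adj x y ∧ y ∉ S}.ncard := by
      intro x hx
      rw [← Set.ncard_coe_finset, ← Set.ncard_union_eq _ (Set.toFinite _) (Set.toFinite _)]
      · congr 1
        ext y
        have h2 := hTS x hx y
        have h3 := @hF.le x y
        simp only [mem_neighborSet, Finset.bipartiteAbove, Finset.coe_filter, Set.mem_union,
          Set.mem_ofPred_eq]
        tauto
      · refine Set.disjoint_left.2 fun y hy hy' => hy'.2 ?_
        exact (Finset.mem_filter.1 (Finset.mem_coe.1 hy)).1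
    have h2 : ∀ s ∈ S, (T.bipartiteBelow F.Adj s).card = f s := by
      intro s hs
      rw [← hS s hs, ← Set.ncard_coe_finset]
      congr 1
      ext y
      have := hST s hs y
      simp only [mem_neighborSet, Finset.bipartiteBelow, Finset.coe_filter, Set.mem_ofPred_eq,
        F.adj_comm y s]
      tauto
    rw [Finset.sum_congr rfl h1, Finset.sum_add_distrib,
      Finset.sum_card_bipartiteAbove_eq_sum_card_bipartiteBelow, Finset.sum_congr rfl h2]
  have hlt : ∑ x ∈ T, (F.neighborSet x).ncard < ∑ x ∈ T, g x :=
    Finset.sum_lt_sum hT ⟨v₀, hv₀T, hv₀⟩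
  have := h S T hdisj
  omega

end Factor

/-! ### Independent sets and isolated toughness -/

/-- Greedy choice of an independent set, by increasing weight. -/
lemma exists_isIndepSet_sum_le {V : Type*} (G : SimpleGraph V) (d : V → ℕ) (a : ℕ)
    (T : Finset V) (hd : ∀ x ∈ T, {y | G.Adj x y ∧ y ∈ T}.ncard ≤ d x) :
    ∃ I ⊆ T, G.IsIndepSet (I : Set V) ∧
      ∑ x ∈ T, (a - d x) ≤ ∑ x ∈ I, (d x + 1) * (a - d x) := by
  classical
  induction T using Finset.strongInduction with
  | H T ih =>
  rcases T.eq_empty_or_nonempty with rfl | hne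
  · exact ⟨∅, by simp, by simp, by simp⟩
  obtain ⟨x, hx, hmin⟩ := T.exists_min_image d hne
  let N : Finset V := {y ∈ T | G.Adj x y}
  have hxN : x ∉ N := by simp [N]
  have hNT : insert x N ⊆ T := Finset.insert_subset hx (Finset.filter_subset _ _)
  have hN : N.card ≤ d x := by
    rw [← Set.ncard_coe_finset]
    convert hd x hx using 2
    ext y
    simp [N, and_comm]
  obtain ⟨I, hI, hind, hsum⟩ := ih (T \ insert x N)
    (Finset.sdiff_ssubset hNT (Finset.insert_nonempty _ _)) (by
      intro z hz
      refine le_trans (Set.ncard_le_ncard ?_ ?_) (hd z (Finset.sdiff_subset hz))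
      · exact fun y hy => ⟨hy.1, Finset.sdiff_subset hy.2⟩
      · exact T.finite_toSet.subset fun y hy => hy.2)
  have hIx : ∀ y ∈ I, y ≠ x ∧ ¬G.Adj x y := by
    intro y hy
    have := Finset.mem_sdiff.1 (hI hy)
    simp only [N, Finset.mem_insert, Finset.mem_filter, not_or, not_and] at this
    exact ⟨this.2.1, this.2.2 this.1⟩
  refine ⟨insert x I, Finset.insert_subset hx (hI.trans Finset.sdiff_subset), ?_, ?_⟩
  · rw [Finset.coe_insert]
    exact hind.insert fun y hy _ => ⟨(hIx y hy).2, fun h => (hIx y hy).2 h.symm⟩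
  · rw [Finset.sum_insert fun h => (hIx x h).1 rfl, ← Finset.sum_sdiff hNT, add_comm]
    refine add_le_add ?_ hsum
    -- The discarded closed neighbourhood has at most `d x + 1` vertices, and `x` has the least `d`.
    calc ∑ y ∈ insert x N, (a - d y) ≤ (insert x N).card • (a - d x) :=
          Finset.sum_le_card_nsmul _ _ _ fun y hy => Nat.sub_le_sub_left (hmin y (hNT hy)) _
      _ ≤ (d x + 1) * (a - d x) := by
          rw [Finset.card_insert_of_notMem hxN, smul_eq_mul]
          exact Nat.mul_le_mul_right _ (by omega)

lemma card_le_isolatedCount {V : Type*} [Finite V] {G : SimpleGraph V} {I S : Finset V}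
    (hIS : Disjoint I S) (h : ∀ x ∈ I, ∀ y, G.Adj x y → y ∈ S) : I.card ≤ G.isolatedCount S := by
  classical
  rw [isolatedCount, ← Set.ncard_image_of_injective _ Subtype.val_injective,
    ← Set.ncard_coe_finset]
  refine Set.ncard_le_ncard (fun x hx => ?_) (Set.toFinite _)
  exact ⟨⟨x, Finset.disjoint_left.1 hIS hx⟩, fun w hw => w.2 (h x hx _ hw), rfl⟩

lemma isolatedToughness_mul_le {V : Type*} [Fintype V] {G : SimpleGraph V} (hG : G ≠ ⊤)
    {I S : Finset V} (hI : 2 ≤ I.card) (hIS : Disjoint I S)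
    (h : ∀ x ∈ I, ∀ y, G.Adj x y → y ∈ S) : G.isolatedToughness * I.card ≤ S.card := by
  have hc := card_le_isolatedCount hIS h
  have hpos : (0 : ℝ) < G.isolatedCount S := by exact_mod_cast (by omega : 0 < G.isolatedCount S)
  have hle := (isLeast_isolatedToughness G hG).2 ⟨S, hI.trans hc, rfl⟩
  obtain ⟨⟨S', -, hS'⟩, -⟩ := isLeast_isolatedToughness G hG
  have h0 : 0 ≤ G.isolatedToughness := by rw [hS']; positivity
  calc G.isolatedToughness * I.card ≤ G.isolatedToughness * G.isolatedCount S := by gcongr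
    _ ≤ S.card := (le_div_iff₀ hpos).1 hle

end SimpleGraph

open SimpleGraph in
theorem theorem2p1 {V : Type*} [Fintype V] (G : SimpleGraph V) [DecidableRel G.Adj]
    (a b n : ℕ) (ha : 1 ≤ a) (hab : a < b) (hn : 1 ≤ n)
    (hdeg : a + n ≤ G.minDegree)
    (hI : (a : ℝ) - 1 + n + ((a : ℝ) - 1) / b ≤ G.isolatedToughness)
    (V' : Finset V) (hV' : V'.card = n) :
    (G.induce (V' : Set V)ᶜ).HasFactor a b := by
  classical
  set W : Set V := (V' : Set V)ᶜ with hW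
  set H := G.induce W with hH
  refine exists_factor_of_forall_disjoint (g := fun _ => a) (f := fun _ => b) H (fun _ => hab)
    fun S T hST => ?_
  let d : W → ℕ := fun x => {y | H.Adj x y ∧ y ∉ S}.ncard
  change ∑ x ∈ T, a ≤ ∑ x ∈ S, b + ∑ x ∈ T, d x
  obtain ⟨I₀, hI₀T, hI₀, hsum⟩ := H.exists_isIndepSet_sum_le d a T fun x _ =>
    Set.ncard_le_ncard (fun y hy => ⟨hy.1, Finset.disjoint_right.1 hST hy.2⟩) (Set.toFinite _)
  -- Dropped terms vanish by truncated subtraction; on `I` the subtraction is genuine.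
  let I := I₀.filter fun x => d x < a
  have hI₀I : I ⊆ I₀ := Finset.filter_subset _ _
  have hId : ∀ x ∈ I, d x < a := fun x hx => (Finset.mem_filter.1 hx).2
  replace hsum : ∑ x ∈ T, (a - d x) ≤ ∑ x ∈ I, (d x + 1) * (a - d x) := by
    refine hsum.trans_eq (Finset.sum_filter_of_ne fun x _ hx => ?_).symm
    by_contra hxa
    exact hx (by rw [Nat.sub_eq_zero_of_le (not_lt.1 hxa), mul_zero])
  suffices hbs : ∑ x ∈ I, (d x + 1) * (a - d x) ≤ b * S.card by
    calc ∑ x ∈ T, a ≤ ∑ x ∈ T, ((a - d x) + d x) :=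
          Finset.sum_le_sum fun x _ => by omega
      _ = ∑ x ∈ T, (a - d x) + ∑ x ∈ T, d x := Finset.sum_add_distrib
      _ ≤ _ := by
          rw [Finset.sum_const, smul_eq_mul, mul_comm S.card]
          exact Nat.add_le_add_right (hsum.trans hbs) _
  rcases Nat.lt_or_ge I.card 2 with hcard | hcard
  · rcases I.eq_empty_or_nonempty with hIe | hIne
    · simp [hIe]
    obtain ⟨x, hx⟩ := Finset.card_eq_one.1 (by have := hIne.card_pos; omega : I.card = 1)
    rw [hx, Finset.sum_singleton]
    have hdx : d x < a := hId x (by simp [hx])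
    have hdegx : a ≤ d x + S.card := by
      have h1 : a + n ≤ (G.neighborFinset x).card := hdeg.trans (G.minDegree_le_degree x)
      have h2 : G.neighborFinset x ⊆
          V' ∪ (S.map (Function.Embedding.subtype _) ∪
            ({y | H.Adj x y ∧ y ∉ S} : Finset W).map (Function.Embedding.subtype _)) := by
        intro y hy
        by_cases hyV : y ∈ V'
        · exact Finset.mem_union_left _ hyV
        refine Finset.mem_union_right _ ?_
        rw [mem_neighborFinset] at hy
        by_cases hyS : (⟨y, hyV⟩ : W) ∈ S
        · exact Finset.mem_union_left _ (Finset.mem_map.2 ⟨_, hyS, rfl⟩)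
        · refine Finset.mem_union_right _ (Finset.mem_map.2 ⟨⟨y, hyV⟩, ?_, rfl⟩)
          exact Finset.mem_filter.2 ⟨Finset.mem_univ _, hy, hyS⟩
      have h3 := (Finset.card_le_card h2).trans
        ((Finset.card_union_le _ _).trans (Nat.add_le_add_left (Finset.card_union_le _ _) _))
      rw [Finset.card_map, Finset.card_map] at h3
      have h4 : d x = ({y | H.Adj x y ∧ y ∉ S} : Finset W).card := by
        rw [← Set.ncard_coe_finset]; simp [d]
      omega
    -- Here `d x + 1 ≤ a < b` and `a - d x ≤ |S|`.
    exact Nat.mul_le_mul (by omega) (by omega)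
  · have hind : H.IsIndepSet (I : Set W) := hI₀.mono (Finset.coe_subset.2 hI₀I)
    have hG : G ≠ ⊤ := by
      rintro rfl
      obtain ⟨x, hx, y, hy, hxy⟩ := Finset.one_lt_card.1 hcard
      exact hind hx hy hxy (by simpa [hH, Subtype.ext_iff] using hxy)
    let N : Finset W := I.biUnion fun x => {y | H.Adj x y ∧ y ∉ S}
    have hNcard : N.card ≤ ∑ x ∈ I, d x := by
      refine Finset.card_biUnion_le.trans_eq (Finset.sum_congr rfl fun x _ => ?_)
      rw [← Set.ncard_coe_finset]; simp [d]
    let S' : Finset V := V' ∪ (S ∪ N).map (Function.Embedding.subtype _)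
    have hS'card : S'.card ≤ n + (S.card + ∑ x ∈ I, d x) := by
      refine (Finset.card_union_le _ _).trans ?_
      rw [hV', Finset.card_map]
      exact Nat.add_le_add_left ((Finset.card_union_le _ _).trans (by omega)) _
    have key := isolatedToughness_mul_le (I := I.map (Function.Embedding.subtype _)) (S := S') hG
      (by rwa [Finset.card_map]) ?_ ?_
    · rw [Finset.card_map] at key
      have hb : (0 : ℝ) < b := by exact_mod_cast (by omega : 0 < b)
      have hSr : (S'.card : ℝ) ≤ n + (S.card + ∑ x ∈ I, (d x : ℝ)) := by exact_mod_cast hS'card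
      have hk : (2 : ℝ) ≤ I.card := by exact_mod_cast hcard
      have hn' : (1 : ℝ) ≤ n := by exact_mod_cast hn
      have hb2 : (2 : ℝ) ≤ b := by exact_mod_cast (by omega : 2 ≤ b)
      have h1 : ((a : ℝ) - 1 + n + ((a : ℝ) - 1) / b) * I.card ≤
          n + (S.card + ∑ x ∈ I, (d x : ℝ)) :=
        (mul_le_mul_of_nonneg_right hI (by positivity)).trans (key.trans hSr)
      -- The two sides differ by exactly `(b - d x)(a - 1 - d x) ≥ 0`.
      have h2 : ∀ x ∈ I, ((d x : ℝ) + 1) * (a - d x) ≤ (b * (a - 1) + (a - 1) + 1) - b * d x := by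
        intro x hx
        have hda : (d x : ℝ) + 1 ≤ a := by exact_mod_cast hId x hx
        have hab' : (a : ℝ) ≤ b := by exact_mod_cast hab.le
        nlinarith [mul_nonneg (by linarith : (0 : ℝ) ≤ b - d x)
          (by linarith : (0 : ℝ) ≤ a - 1 - d x)]
      have h3 := Finset.sum_le_sum h2
      rw [Finset.sum_sub_distrib, Finset.sum_const, nsmul_eq_mul, ← Finset.mul_sum] at h3
      have h4 : (b : ℝ) * (((a : ℝ) - 1 + n + ((a : ℝ) - 1) / b) * I.card) =
          (b * (a - 1) + b * n + (a - 1)) * I.card := by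
        field_simp
      have h5 := mul_le_mul_of_nonneg_left h1 hb.le
      rw [h4] at h5
      -- Absorbs the surplus `|I| + bn - bn|I|` left by `h3` and `h5`; it needs `|I| ≥ 2` and `bn ≥
      -- 2`.
      have h6 : (I.card : ℝ) ≤ b * n * (I.card - 1) := by
        have : (2 : ℝ) ≤ b * n := by nlinarith
        nlinarith
      have h7 : ∑ x ∈ I, ((d x : ℝ) + 1) * (a - d x) ≤ b * S.card := by linarith
      have h8 : ((∑ x ∈ I, (d x + 1) * (a - d x) : ℕ) : ℝ) =
          ∑ x ∈ I, ((d x : ℝ) + 1) * (a - d x) := by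
        rw [Nat.cast_sum]
        refine Finset.sum_congr rfl fun x hx => ?_
        rw [Nat.cast_mul, Nat.cast_sub (hId x hx).le]
        push_cast
        rfl
      rw [← h8] at h7
      exact_mod_cast h7
    · refine Finset.disjoint_left.2 fun x hx hx' => ?_
      obtain ⟨x, hxI, rfl⟩ := Finset.mem_map.1 hx
      rcases Finset.mem_union.1 hx' with hx' | hx'
      · exact x.2 hx'
      · rw [Finset.mem_map' _] at hx'
        rcases Finset.mem_union.1 hx' with hx' | hx'
        · exact Finset.disjoint_left.1 hST hx' (hI₀T (hI₀I hxI))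
        · obtain ⟨z, hz, hzx⟩ := Finset.mem_biUnion.1 hx'
          have hadj := (Finset.mem_filter.1 hzx).2.1
          exact hind hz hxI hadj.ne hadj
    · intro x hx y hxy
      obtain ⟨x, hxI, rfl⟩ := Finset.mem_map.1 hx
      by_cases hyV : y ∈ V'
      · exact Finset.mem_union_left _ hyV
      refine Finset.mem_union_right _ (Finset.mem_map.2 ⟨⟨y, hyV⟩, ?_, rfl⟩)
      by_cases hyS : (⟨y, hyV⟩ : W) ∈ S
      · exact Finset.mem_union_left _ hyS
      · refine Finset.mem_union_right _ (Finset.mem_biUnion.2 ⟨x, hxI, ?_⟩)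
        exact Finset.mem_filter.2 ⟨Finset.mem_univ _, hxy, hyS⟩
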